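/- Let $p\ge 2$. An instance of a $p$-objective problem consists of a set $X$ of feasible solutions and objective functions $f_1,\dots,f_p:X\to\mathbb{Q}_{>0}$, all to be minimized (for knapsack: all to be maximized). For $\varepsilon>0$, a set $P\subseteq X$ is a \emph{one-exact, quasi-$2$-exact $(1+\varepsilon)$-approximation set} if for every $x'\in X$ there are $x\in P$ and a vector $\alpha\in\{1,1+\varepsilon\}^p$ with $\alpha_1=1$, exactly one further component equal to $1$ and the remaining $p-2$ components equal to $1+\varepsilon$, such that $f_i(x)\le\alpha_i f_i(x')$ for all $i$ (for maximization: $f_i(x')\le\alpha_i f_i(x)$ for all $i$). Let $\Pi$ be any of the following $p$-objective problems (with positive rational cost, respectively profit, vectors): shortest $s$-$t$-path (in directed graphs), minimum spanning tree, assignment, minimum $s$-$t$-cut (in directed graphs), knapsack (over nonempty item sets that respect the capacity), and (symmetric) traveling salesman. Then $\Pi$ has instances that do not admit polynomial-cardinality one-exact, quasi-$2$-exact $(1+\varepsilon)$-approximation sets for any $\varepsilon>0$. Precisely: there is a sequence of instances $I_1,I_2,\dots$ of $\Pi$, all of whose objective values are positive, such that for every polynomial $q$ and all sufficiently large $n$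 the following holds: for every $\varepsilon>0$, every one-exact, quasi-$2$-exact $(1+\varepsilon)$-approximation set $P$ for $I_n$ satisfies $|P|>q(\mathrm{enc}(I_n))$, where $\mathrm{enc}(I_n)$ is the encoding length of $I_n$ in binary. -/

import Mathlib

namespace MOO

/-- Whether all objectives of a problem are to be minimized or maximized. -/
inductive Sense where
  | minimize
  | maximize

/-- A multiobjective optimization problem with `p` rational objective functions: a type of
instances, each with an encoding length, a set of feasible solutions and an objective vector. -/
structure Problem (p : ℕ) where
  sense : Sense
  Inst : Type
  enc : Inst → ℕ
  Sol : Inst → Type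
  obj : (I : Inst) → Sol I → Fin p → ℚ

/-- `x` approximates `x'` with guarantee vector `α`. -/
def Approximates {p : ℕ} (Pr : Problem p) (I : Pr.Inst) (α : Fin p → ℝ) (x x' : Pr.Sol I) :
    Prop :=
  match Pr.sense with
  | Sense.minimize => ∀ i, (Pr.obj I x i : ℝ) ≤ α i * (Pr.obj I x' i : ℝ)
  | Sense.maximize => ∀ i, (Pr.obj I x' i : ℝ) ≤ α i * (Pr.obj I x i : ℝ)

/-- One-exact, quasi-`k`-exact `(1+ε)`-dominance: `x` approximates `x'` for some guarantee vector
in which exactly `k` components, one of which is the first, are `1` and the others are `1+ε`. -/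
def OneExactQuasiExactDom {p : ℕ} (Pr : Problem p) (I : Pr.Inst) (k : ℕ) (ε : ℝ)
    (x x' : Pr.Sol I) : Prop :=
  ∃ K : Finset (Fin p), K.card = k ∧ (∃ i ∈ K, (i : ℕ) = 0) ∧
    Approximates Pr I (fun i => if i ∈ K then 1 else 1 + ε) x x'

/-- `P` is an `R`-approximation set: every feasible solution is `R`-dominated by a member of
`P`. -/
def IsApproximationSet {X : Type} (R : X → X → Prop) (P : Set X) : Prop :=
  ∀ x' : X, ∃ x ∈ P, R x x'

/-- Binary encoding length of a rational number (sign, numerator and denominator). -/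
def encRat (r : ℚ) : ℕ := 1 + Nat.size r.num.natAbs + Nat.size r.den

/-- Binary encoding length of a rational vector. -/
def encVec {p : ℕ} (v : Fin p → ℚ) : ℕ := ∑ i, encRat (v i)

/-- A finite simple directed graph on the vertices `0, …, n-1` with two distinct terminals
`s`, `t` and a positive rational cost vector on every arc (values of `cost` off the arcs are
irrelevant). -/
structure DirectedNetwork (p : ℕ) where
  n : ℕ
  s : Fin n
  t : Fin n
  s_ne_t : s ≠ t
  arcs : Finset (Fin n × Fin n)
  no_loops : ∀ a ∈ arcs, a.1 ≠ a.2
  cost : Fin n × Fin n → Fin p → ℚ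
  cost_pos : ∀ a ∈ arcs, ∀ i, 0 < cost a i

/-- Encoding length of a directed network: the vertices, the two terminals, and the list of arcs
(two end vertices and a cost vector each). -/
def DirectedNetwork.enc {p : ℕ} (N : DirectedNetwork p) : ℕ :=
  N.n + 2 * Nat.size N.n + ∑ a ∈ N.arcs, (2 * Nat.size N.n + encVec (N.cost a))

/-- A simple directed path from `s` to `t`, given by its sequence of vertices. -/
def DirectedNetwork.IsPath {p : ℕ} (N : DirectedNetwork p) (l : List (Fin N.n)) : Prop :=
  l.head? = some N.s ∧ l.getLast? = some N.t ∧ l.Nodup ∧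
    l.IsChain (fun u v => (u, v) ∈ N.arcs)

/-- Multiobjective shortest path: minimize the total arc costs of a simple directed
`s`-`t`-path. -/
def shortestPath (p : ℕ) : Problem p where
  sense := Sense.minimize
  Inst := DirectedNetwork p
  enc := DirectedNetwork.enc
  Sol N := {l : List (Fin N.n) // N.IsPath l}
  obj N l i := ((l.1.zip l.1.tail).map (fun a => N.cost a i)).sum

/-- Multiobjective minimum `s`-`t`-cut: choose a vertex set that contains `s` but not `t` and
minimize the total costs of the arcs leaving it. -/
def minCut (p : ℕ) : Problem p where
  sense := Sense.minimize
  Inst := DirectedNetwork p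
  enc := DirectedNetwork.enc
  Sol N := {S : Finset (Fin N.n) // N.s ∈ S ∧ N.t ∉ S}
  obj N S i := ∑ a ∈ N.arcs with a.1 ∈ S.1 ∧ a.2 ∉ S.1, N.cost a i

/-- A finite simple undirected graph on the vertices `0, …, n-1` with a positive rational cost
vector on every edge (values of `cost` off the edges are irrelevant). -/
structure UndirectedNetwork (p : ℕ) where
  n : ℕ
  edges : Finset (Sym2 (Fin n))
  no_loops : ∀ e ∈ edges, ¬ e.IsDiag
  cost : Sym2 (Fin n) → Fin p → ℚ
  cost_pos : ∀ e ∈ edges, ∀ i, 0 < cost e i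

/-- Encoding length of an undirected network: the vertices and the list of edges. -/
def UndirectedNetwork.enc {p : ℕ} (N : UndirectedNetwork p) : ℕ :=
  N.n + ∑ e ∈ N.edges, (2 * Nat.size N.n + encVec (N.cost e))

/-- Multiobjective minimum spanning tree: minimize the total edge costs of a spanning tree,
given by its edge set. -/
def spanningTree (p : ℕ) : Problem p where
  sense := Sense.minimize
  Inst := UndirectedNetwork p
  enc := UndirectedNetwork.enc
  Sol N := {F : Finset (Sym2 (Fin N.n)) //
    F ⊆ N.edges ∧ (SimpleGraph.fromEdgeSet (F : Set (Sym2 (Fin N.n)))).IsTree}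
  obj N F i := ∑ e ∈ F.1, N.cost e i

/-- An instance of the assignment problem: `n` agents, `n` tasks and a positive rational cost
vector for every agent-task pair. -/
structure AssignmentInstance (p : ℕ) where
  n : ℕ
  cost : Fin n → Fin n → Fin p → ℚ
  cost_pos : ∀ a b i, 0 < cost a b i

/-- Multiobjective assignment: minimize the total costs of a bijection between agents and
tasks. -/
def assignment (p : ℕ) : Problem p where
  sense := Sense.minimize
  Inst := AssignmentInstance p
  enc I := I.n + ∑ a, ∑ b, encVec (I.cost a b)
  Sol I := Equiv.Perm (Fin I.n)
  obj I σ i := ∑ a, I.cost a (σ a) i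

/-- An instance of the knapsack problem: items with positive rational weights and positive
rational profit vectors, and a positive rational capacity. -/
structure KnapsackInstance (p : ℕ) where
  n : ℕ
  weight : Fin n → ℚ
  weight_pos : ∀ a, 0 < weight a
  capacity : ℚ
  capacity_pos : 0 < capacity
  profit : Fin n → Fin p → ℚ
  profit_pos : ∀ a i, 0 < profit a i

/-- Multiobjective 0-1 knapsack: maximize the total profits of a set of items whose total weight
is at most the capacity. The empty selection is left out, since objective values are positive. -/
def knapsack (p : ℕ) : Problem p where
  sense := Sense.maximize
  Inst := KnapsackInstance p
  enc I := I.n + encRat I.capacity + ∑ a, (encRat (I.weight a) + encVec (I.profit a))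
  Sol I := {S : Finset (Fin I.n) // S.Nonempty ∧ ∑ a ∈ S, I.weight a ≤ I.capacity}
  obj I S i := ∑ a ∈ S.1, I.profit a i

/-- An instance of the (symmetric) traveling salesman problem: at least three cities and a
positive rational cost vector for every pair of distinct cities. -/
structure TSPInstance (p : ℕ) where
  n : ℕ
  three_le : 3 ≤ n
  cost : Sym2 (Fin n) → Fin p → ℚ
  cost_pos : ∀ e, ¬ e.IsDiag → ∀ i, 0 < cost e i

/-- Multiobjective traveling salesman: minimize the total costs of a tour through all cities. A
tour is given by its successor map, a permutation of the cities that is one single cycle. -/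
def travelingSalesman (p : ℕ) : Problem p where
  sense := Sense.minimize
  Inst := TSPInstance p
  enc I := I.n + ∑ e : Sym2 (Fin I.n) with ¬ e.IsDiag, encVec (I.cost e)
  Sol I := {σ : Equiv.Perm (Fin I.n) // σ.IsCycleOn Set.univ}
  obj I σ i := ∑ v, I.cost s(v, σ.1 v) i

end MOO

namespace MOO

open Finset

/-! Every instance has only two different objectives, F in the first component and G in all others.
A guarantee vector with two exact components, one of them the first, then forces exact dominance in
both F and G, so ε plays no role. It suffices to exhibit at least 2^n solutions with distinct values
of F such that any solution dominating one of them has the same value of F: an approximation set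
must then realize all these values, while the encoding length is polynomial in n.

For spanning trees, assignments, cuts and tours, the instances are built so that all solutions
select equally many elements, and each element costs (w, C - w) with C constant. Hence F + G is
constant, and dominance forces equality. The weights are 1 plus a power of two on special elements,
and every set of special elements is realized by some solution, so F reads off all subsets in binary
(`hasHardInstances_of_uniform`).

Shortest paths and knapsack use `hasHardInstances_of_biobjective` directly. Along a path the number
of arcs varies, but F + G is proportional to the total arc length, which telescopes. In knapsack F +
G is proportional to the number of items, which is maximal for the selections that fill the
capacity; there are a central binomial coefficient of them. -/

/-- The problem has positive instances whose one-exact, quasi-`2`-exact approximation sets have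
superpolynomial cardinality. -/
def HasHardInstances {p : ℕ} (Pr : Problem p) : Prop :=
  ∃ I : ℕ → Pr.Inst,
    (∀ (n : ℕ) (x : Pr.Sol (I n)) (i : Fin p), 0 < Pr.obj (I n) x i) ∧
    ∀ q : Polynomial ℕ, ∀ᶠ n in Filter.atTop, ∀ ε : ℝ, 0 < ε →
      ∀ P : Set (Pr.Sol (I n)),
        IsApproximationSet (OneExactQuasiExactDom Pr (I n) 2 ε) P →
          ((q.eval (Pr.enc (I n)) : ℕ) : ℕ∞) < P.encard

/-! ### Polynomial growth against powers of two. -/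

theorem polynomial_eval_mono (q : Polynomial ℕ) {a b : ℕ} (h : a ≤ b) : q.eval a ≤ q.eval b := by
  simp only [Polynomial.eval_eq_sum_range]
  gcongr

theorem polynomial_eval_isLittleO (q : Polynomial ℕ) :
    (fun n : ℕ => ((q.eval n : ℕ) : ℝ)) =o[Filter.atTop] fun n : ℕ => (2 : ℝ) ^ n := by
  induction q using Polynomial.induction_on' with
  | add a b ha hb => simpa using ha.add hb
  | monomial k a =>
    simpa using (isLittleO_pow_const_const_pow_of_one_lt (R := ℝ) k one_lt_two).const_mul_left
      (a : ℝ)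

theorem eventually_polynomial_eval_lt_two_pow (q : Polynomial ℕ) :
    ∀ᶠ n : ℕ in Filter.atTop, q.eval n < 2 ^ n := by
  filter_upwards [(polynomial_eval_isLittleO q).bound (c := 1 / 2) (by norm_num)] with n hn
  have h2 : (0 : ℝ) < 2 ^ n := by positivity
  rw [Real.norm_of_nonneg (by positivity), Real.norm_of_nonneg h2.le] at hn
  have : ((q.eval n : ℕ) : ℝ) < 2 ^ n := by linarith
  exact_mod_cast this

/-- Supplies the second exact component; which one it is does not matter when all objectives after
the first coincide. -/
theorem exists_mem_ne_zero_of_card_two {p : ℕ} {K : Finset (Fin p)} (hK : #K = 2) :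
    ∃ j ∈ K, (j : ℕ) ≠ 0 := by
  by_contra! h
  have : #K ≤ 1 := card_le_one.2 fun a ha b hb => Fin.ext ((h a ha).trans (h b hb).symm)
  omega

/-- If all objectives but the first agree, and a family of exponentially many solutions has
distinct first objective values and is not dominated by solutions of another first objective
value, then the problem has hard instances. -/
theorem hasHardInstances_of_biobjective {p : ℕ} (Pr : Problem p) (I : ℕ → Pr.Inst)
    (r : Polynomial ℕ) (henc : ∀ n, Pr.enc (I n) ≤ r.eval n)
    (F G : ∀ n, Pr.Sol (I n) → ℚ)
    (hobj : ∀ n x i, Pr.obj (I n) x i = if (i : ℕ) = 0 then F n x else G n x)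
    (hF : ∀ n x, 0 < F n x) (hG : ∀ n x, 0 < G n x)
    (ι : ℕ → Type) [∀ n, Fintype (ι n)] (hι : ∀ n, 2 ^ n ≤ Fintype.card (ι n))
    (y : ∀ n, ι n → Pr.Sol (I n)) (hinj : ∀ n, Function.Injective fun a => F n (y n a))
    (hmin : Pr.sense = Sense.minimize → ∀ n a x, F n x ≤ F n (y n a) → G n x ≤ G n (y n a) →
      F n x = F n (y n a))
    (hmax : Pr.sense = Sense.maximize → ∀ n a x, F n (y n a) ≤ F n x → G n (y n a) ≤ G n x →
      F n x = F n (y n a)) :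
    HasHardInstances Pr := by
  refine ⟨I, fun n x i => ?_, fun q => ?_⟩
  · rw [hobj]
    split_ifs
    exacts [hF n x, hG n x]
  -- Composing with `r` bounds the size in terms of n. The threshold is chosen before ε, hence
  -- uniform in it.
  filter_upwards [eventually_polynomial_eval_lt_two_pow (q.comp r)] with n hn ε hε P hP
  have hlt : q.eval (Pr.enc (I n)) < Fintype.card (ι n) :=
    ((polynomial_eval_mono q (henc n)).trans_lt (by simpa using hn)).trans_le (hι n)
  -- Only the values of F on `P` are counted: each value of the family must occur there.
  have hsub : Set.range (fun a => F n (y n a)) ⊆ F n '' P := by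
    rintro _ ⟨a, rfl⟩
    obtain ⟨x, hx, K, hK, ⟨i, hi, hi0⟩, happ⟩ := hP (y n a)
    obtain ⟨j, hj, hj0⟩ := exists_mem_ne_zero_of_card_two hK
    refine ⟨x, hx, ?_⟩
    rcases hs : Pr.sense with _ | _
    · simp only [Approximates, hs] at happ
      have h1 := happ i
      have h2 := happ j
      simp only [hi, hj, if_true, one_mul, hobj, hi0, hj0, if_false, Rat.cast_le] at h1 h2
      exact hmin hs n a x h1 h2
    · simp only [Approximates, hs] at happ
      have h1 := happ i
      have h2 := happ j
      simp only [hi, hj, if_true, one_mul, hobj, hi0, hj0, if_false, Rat.cast_le] at h1 h2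
      exact hmax hs n a x h1 h2
  calc ((q.eval (Pr.enc (I n)) : ℕ) : ℕ∞) < (Fintype.card (ι n) : ℕ) := by exact_mod_cast hlt
    _ = (Set.range fun a => F n (y n a)).encard := by
      rw [← Set.image_univ, (hinj n).encard_image, Set.encard_univ, ENat.card_eq_coe_fintype_card]
    _ ≤ (F n '' P).encard := Set.encard_le_encard hsub
    _ ≤ P.encard := Set.encard_image_le _ _

/-! ### Two-valued cost vectors, their encoding length, and binary expansions. -/

/-- The vector with first component `a` and all other components `b`. -/
def biVec (p a b : ℕ) : Fin p → ℚ := fun i => if (i : ℕ) = 0 then (a : ℚ) else (b : ℚ)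

theorem biVec_pos {p a b : ℕ} (ha : 0 < a) (hb : 0 < b) (i : Fin p) : 0 < biVec p a b i := by
  unfold biVec
  split_ifs <;> exact_mod_cast ‹_›

theorem encRat_natCast_le {a k : ℕ} (h : a < 2 ^ k) : encRat (a : ℚ) ≤ k + 2 := by
  have := Nat.size_le.2 h
  simp [encRat]
  omega

theorem encVec_biVec_le {p a b k : ℕ} (ha : a < 2 ^ k) (hb : b < 2 ^ k) :
    encVec (biVec p a b) ≤ p * (k + 2) := by
  calc encVec (biVec p a b) ≤ ∑ _i : Fin p, (k + 2) := by
        refine sum_le_sum fun i _ => ?_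
        unfold biVec
        split_ifs
        exacts [encRat_natCast_le ha, encRat_natCast_le hb]
    _ = p * (k + 2) := by simp

theorem size_le_self (n : ℕ) : Nat.size n ≤ n := Nat.size_le.2 Nat.lt_two_pow_self

/-- Uniqueness of binary expansions; this is what makes the first objective separate subsets. -/
theorem sum_two_pow_fin_injective (k : ℕ) :
    Function.Injective fun S : Finset (Fin k) => ∑ i ∈ S, 2 ^ (i : ℕ) := by
  intro S T h
  refine map_injective Fin.valEmbedding (geomSum_injective le_rfl ?_)
  simpa using h

theorem sum_two_pow_fin_lt {k : ℕ} (S : Finset (Fin k)) : ∑ i ∈ S, 2 ^ (i : ℕ) < 2 ^ k := by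
  have h : ∑ i ∈ S, 2 ^ (i : ℕ) = ∑ i ∈ S.map Fin.valEmbedding, 2 ^ i := by simp
  rw [h]
  refine Nat.geomSum_lt (by norm_num) fun i hi => ?_
  obtain ⟨j, -, rfl⟩ := mem_map.1 hi
  exact j.2

/-! ### Selections of fixed size with constant cost sum per element. -/

section Uniform

variable {α : Type} [DecidableEq α] {k : ℕ}

/-- Weights `1 + 2 ^ i` on the special elements `sp i`, and `1` elsewhere. -/
def specialWeight (sp : Fin k → α) (e : α) : ℕ := 1 + ∑ i, if e = sp i then 2 ^ (i : ℕ) else 0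

theorem specialWeight_pos (sp : Fin k → α) (e : α) : 0 < specialWeight sp e := by
  unfold specialWeight
  omega

/-- Distinct indices contribute distinct powers below 2^k, so the bound needs no injectivity of
`sp`. -/
theorem specialWeight_le (sp : Fin k → α) (e : α) : specialWeight sp e ≤ 2 ^ k := by
  unfold specialWeight
  rw [← sum_filter]
  have := sum_two_pow_fin_lt (univ.filter fun i => e = sp i)
  omega

/-- Once the cardinality is fixed and the multiplicities are 0 or 1, the weight is a constant plus
the binary number whose digits are these multiplicities. -/
theorem sum_map_specialWeight (sp : Fin k → α) (M : Multiset α) :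
    (M.map (specialWeight sp)).sum = M.card + ∑ i, M.count (sp i) * 2 ^ (i : ℕ) := by
  induction M using Multiset.induction_on with
  | empty => simp
  | cons a M ih =>
    simp only [Multiset.map_cons, Multiset.sum_cons, ih, Multiset.card_cons, Multiset.count_cons,
      add_mul, sum_add_distrib, specialWeight, ite_mul, one_mul, zero_mul, eq_comm (a := a)]
    ring

/-- Cost vectors whose first two components always add up to `2 ^ (k + 1)`. -/
def uniformCost (p : ℕ) (sp : Fin k → α) (e : α) : Fin p → ℚ :=
  biVec p (specialWeight sp e) (2 ^ (k + 1) - specialWeight sp e)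

theorem uniformCost_pos (p : ℕ) (sp : Fin k → α) (e : α) (i : Fin p) :
    0 < uniformCost p sp e i := by
  have := specialWeight_le sp e
  refine biVec_pos (specialWeight_pos sp e) ?_ i
  have : 0 < 2 ^ k := by positivity
  rw [pow_succ]
  omega

theorem encVec_uniformCost_le (p : ℕ) (sp : Fin k → α) (e : α) :
    encVec (uniformCost p sp e) ≤ p * (k + 3) := by
  have h1 := specialWeight_le sp e
  have h2 := specialWeight_pos sp e
  have h3 : 0 < 2 ^ k := by positivity
  refine encVec_biVec_le (k := k + 1) ?_ ?_ <;> rw [pow_succ] <;> omega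

theorem sum_map_uniformCost (p : ℕ) (sp : Fin k → α) (M : Multiset α) (i : Fin p) :
    (M.map fun e => uniformCost p sp e i).sum =
      if (i : ℕ) = 0 then (((M.map (specialWeight sp)).sum : ℕ) : ℚ)
      else 2 ^ (k + 1) * M.card - (((M.map (specialWeight sp)).sum : ℕ) : ℚ) := by
  induction M using Multiset.induction_on with
  | empty => simp
  | cons a M ih =>
    -- Ensures that the natural subtraction in `uniformCost` is not truncated.
    have h : specialWeight sp a ≤ 2 ^ (k + 1) :=
      (specialWeight_le sp a).trans (Nat.pow_le_pow_right (by norm_num) (by omega))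
    rw [Multiset.map_cons, Multiset.sum_cons, ih, Multiset.map_cons, Multiset.sum_cons,
      Multiset.card_cons, uniformCost, biVec, Nat.cast_sub h, Nat.cast_add, Nat.cast_add]
    split_ifs
    · rfl
    · push_cast
      ring

theorem sum_map_specialWeight_le (sp : Fin k → α) (M : Multiset α) :
    (M.map (specialWeight sp)).sum ≤ 2 ^ k * M.card := by
  have h := Multiset.sum_le_card_nsmul (M.map (specialWeight sp)) (2 ^ k) (by
    intro x hx
    obtain ⟨e, -, rfl⟩ := Multiset.mem_map.1 hx
    exact specialWeight_le sp e)
  simpa [mul_comm] using h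

end Uniform

/-- A minimization problem whose solutions select a fixed number of elements, priced by
`uniformCost`, has hard instances as soon as every set of special elements is the special part of
a solution. -/
theorem hasHardInstances_of_uniform {p : ℕ} (Pr : Problem p) (hs : Pr.sense = Sense.minimize)
    (I : ℕ → Pr.Inst) (r : Polynomial ℕ) (henc : ∀ n, Pr.enc (I n) ≤ r.eval n)
    (α : ℕ → Type) [∀ n, DecidableEq (α n)] (sp : ∀ n, Fin n → α n)
    (sel : ∀ n, Pr.Sol (I n) → Multiset (α n))
    (hobj : ∀ n x i, Pr.obj (I n) x i = ((sel n x).map fun e => uniformCost p (sp n) e i).sum)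
    (N : ℕ → ℕ) (hN : ∀ n, 0 < N n) (hcard : ∀ n x, (sel n x).card = N n)
    (hy : ∀ n (S : Finset (Fin n)), ∃ x : Pr.Sol (I n), ∀ i,
      (sel n x).count (sp n i) = if i ∈ S then 1 else 0) :
    HasHardInstances Pr := by
  choose y hy using hy
  refine hasHardInstances_of_biobjective Pr I r henc
    (fun n x => ((((sel n x).map (specialWeight (sp n))).sum : ℕ) : ℚ))
    (fun n x => 2 ^ (n + 1) * N n - ((((sel n x).map (specialWeight (sp n))).sum : ℕ) : ℚ))
    (fun n x i => ?_) (fun n x => ?_) (fun n x => ?_) (fun n => Finset (Fin n)) (fun n => by simp) y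
    (fun n S T h => ?_) (fun _ n S x h1 h2 => ?_) (fun h => ?_)
  · rw [hobj, sum_map_uniformCost, hcard]
  · have := hN n
    have h : 0 < ((sel n x).map (specialWeight (sp n))).sum := by
      rw [sum_map_specialWeight, hcard]
      omega
    exact_mod_cast h
  · have h : (((sel n x).map (specialWeight (sp n))).sum : ℚ) ≤ 2 ^ n * N n := by
      have := sum_map_specialWeight_le (sp n) (sel n x)
      rw [hcard] at this
      exact_mod_cast this
    have h2 : (0 : ℚ) < 2 ^ n * N n := by
      have := hN n
      positivity
    rw [pow_succ]
    push_cast at h ⊢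
    linarith
  · simp only [Nat.cast_inj, sum_map_specialWeight, hcard, hy, ite_mul, one_mul, zero_mul,
      ← sum_filter, add_right_inj] at h
    simpa using sum_two_pow_fin_injective n (by simpa using h)
  -- F + G is constant, so the inequality for G is the reverse inequality for F.
  · exact le_antisymm h1 ((sub_le_sub_iff_left _).1 h2)
  · rw [hs] at h
    cases h

theorem card_sym2_fin_le (n : ℕ) : Fintype.card (Sym2 (Fin n)) ≤ n * n := by
  simpa using Fintype.card_le_of_surjective (fun a : Fin n × Fin n => s(a.1, a.2)) fun e =>
    Sym2.ind (fun a b => ⟨(a, b), rfl⟩) e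

/-! ### Assignment -/

/-- A cycle through the complement of S moves all of it, except that a single point cannot be moved
alone. The extra point 0 joins the cycle to rule that case out. -/
theorem exists_perm_fixing_exactly {k : ℕ} (S : Finset (Fin k)) :
    ∃ σ : Equiv.Perm (Fin (k + 1)), ∀ i : Fin k, σ i.succ = i.succ ↔ i ∈ S := by
  let T : Finset (Fin (k + 1)) := insert 0 (Sᶜ.map (Fin.succEmb k))
  refine ⟨T.toList.formPerm, fun i => ?_⟩
  have hmem : i.succ ∈ T ↔ i ∉ S := by simp [T]
  by_cases hi : i ∈ S
  · exact iff_of_true (List.formPerm_apply_of_notMem (by simpa [hmem] using hi)) hi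
  · refine iff_of_false ?_ hi
    have hT : i.succ ∈ T := hmem.2 hi
    rw [List.formPerm_apply_mem_eq_self_iff _ T.nodup_toList _ (by simpa using hT)]
    have : 1 < #T := one_lt_card.2 ⟨0, by simp [T], i.succ, hT, (Fin.succ_ne_zero i).symm⟩
    simpa using this

/-- Agent `i + 1` is special at task `i + 1`. -/
abbrev assignmentInstance (p k : ℕ) : AssignmentInstance p where
  n := k + 1
  cost a b := uniformCost p (fun i : Fin k => (i.succ, i.succ)) (a, b)
  cost_pos _ _ := uniformCost_pos _ _ _

theorem assignment_hasHardInstances (p : ℕ) : HasHardInstances (assignment p) := by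
  refine hasHardInstances_of_uniform (assignment p) rfl (assignmentInstance p)
    ((.X + 1) + (.X + 1) * ((.X + 1) * ((p : Polynomial ℕ) * (.X + 3)))) (fun k => ?_)
    (fun k => Fin (k + 1) × Fin (k + 1)) (fun k i => (i.succ, i.succ))
    (fun k (σ : Equiv.Perm (Fin (k + 1))) => univ.val.map fun a => (a, σ a))
    (fun k σ i => ?_) (fun k => k + 1) (fun k => k.succ_pos) (fun k σ => by simp)
    (fun k S => ?_)
  · simp only [Polynomial.eval_add, Polynomial.eval_mul, Polynomial.eval_X, Polynomial.eval_one,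
      Polynomial.eval_natCast, Polynomial.eval_ofNat]
    refine Nat.add_le_add_left ?_ _
    calc _ ≤ ∑ _a : Fin (k + 1), ∑ _b : Fin (k + 1), p * (k + 3) :=
          sum_le_sum fun a _ => sum_le_sum fun b _ => encVec_uniformCost_le p _ _
      _ = _ := by simp
  · rw [Multiset.map_map]
    rfl
  · obtain ⟨σ, hσ⟩ := exists_perm_fixing_exactly S
    refine ⟨σ, fun i => ?_⟩
    rw [Multiset.count_map]
    change #(univ.filter fun a : Fin (k + 1) => (i.succ, i.succ) = (a, σ a)) = _
    split_ifs with hi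
    · rw [card_eq_one]
      refine ⟨i.succ, ?_⟩
      ext a
      simp only [mem_filter, mem_univ, true_and, mem_singleton, Prod.mk.injEq]
      constructor
      · exact fun h => h.1.symm
      · rintro rfl
        exact ⟨rfl, ((hσ i).2 hi).symm⟩
    · rw [card_eq_zero, filter_eq_empty_iff]
      rintro a - h
      obtain ⟨h1, h2⟩ := Prod.mk.inj h
      subst h1
      exact hi ((hσ i).1 h2.symm)

/-! ### Spanning trees -/

/-- The edge set that joins every vertex `v + 1` to a smaller vertex `q v`. -/
def parentEdges {m : ℕ} (q : Fin m → Fin (m + 1)) : Finset (Sym2 (Fin (m + 1))) :=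
  univ.image fun v => s(q v, v.succ)

/-- Following parents strictly decreases the vertex, so everything is connected to 0. The larger
endpoint identifies each edge, so there are exactly m edges on m + 1 vertices. -/
theorem parentEdges_isTree {m : ℕ} {q : Fin m → Fin (m + 1)} (hq : ∀ v, q v < v.succ) :
    (SimpleGraph.fromEdgeSet (parentEdges q : Set (Sym2 (Fin (m + 1))))).IsTree := by
  set G := SimpleGraph.fromEdgeSet (parentEdges q : Set (Sym2 (Fin (m + 1)))) with hG
  have hadj : ∀ v, G.Adj (q v) v.succ := fun v => by
    rw [hG, SimpleGraph.fromEdgeSet_adj]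
    exact ⟨mem_coe.2 (mem_image_of_mem _ (mem_univ v)), (hq v).ne⟩
  have hreach : ∀ (l : ℕ) (v : Fin (m + 1)), (v : ℕ) ≤ l → G.Reachable 0 v := by
    intro l
    induction l with
    | zero =>
      intro v hv
      rw [show v = 0 from Fin.ext (by simpa using hv)]
    | succ l ih =>
      intro v hv
      refine Fin.cases (fun _ => SimpleGraph.Reachable.refl _) (fun w hw => ?_) v hv
      refine (ih (q w) ?_).trans (hadj w).reachable
      have := hq w
      rw [Fin.lt_def] at this
      omega
  rw [SimpleGraph.isTree_iff_connected_and_card]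
  constructor
  · rw [SimpleGraph.connected_iff]
    exact ⟨fun u v => (hreach _ u le_rfl).symm.trans (hreach _ v le_rfl), inferInstance⟩
  · have hset : G.edgeSet = parentEdges q := by
      rw [hG, SimpleGraph.edgeSet_fromEdgeSet, sdiff_eq_left, Set.disjoint_left]
      intro e he hd
      obtain ⟨v, -, rfl⟩ := mem_image.1 (mem_coe.1 he)
      exact (hq v).ne (by simpa using hd)
    have hcard : #(parentEdges q) = m := by
      rw [parentEdges, card_image_of_injective, card_univ, Fintype.card_fin]
      intro u v h
      have hu := hq u
      have hv := hq v
      rcases Sym2.eq_iff.1 h with ⟨-, h⟩ | ⟨h1, h2⟩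
      · exact Fin.succ_injective _ h
      · rw [h1] at hu
        rw [← h2] at hv
        exact absurd (hu.trans hv) (lt_irrefl _)
    rw [hset]
    simp [hcard]

/-- The complete graph on `k + 2` vertices in which the edges from `0` to `i + 2` are special. -/
abbrev treeInstance (p k : ℕ) : UndirectedNetwork p where
  n := k + 2
  edges := univ.filter fun e => ¬ e.IsDiag
  no_loops _ he := (mem_filter.1 he).2
  cost := uniformCost p fun i : Fin k => s(0, i.succ.succ)
  cost_pos _ _ := uniformCost_pos _ _ _

theorem spanningTree_hasHardInstances (p : ℕ) : HasHardInstances (spanningTree p) := by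
  refine hasHardInstances_of_uniform (spanningTree p) rfl (treeInstance p)
    ((.X + 2) + (.X + 2) * (.X + 2) * (2 * (.X + 2) + (p : Polynomial ℕ) * (.X + 3)))
    (fun k => ?_) (fun k => Sym2 (Fin (k + 2))) (fun k i => s(0, i.succ.succ))
    (fun k F => F.1.val) (fun k F i => rfl) (fun k => k + 1) (fun k => k.succ_pos)
    (fun k F => ?_) (fun k S => ?_)
  · simp only [Polynomial.eval_add, Polynomial.eval_mul, Polynomial.eval_X,
      Polynomial.eval_natCast, Polynomial.eval_ofNat]
    refine Nat.add_le_add_left ?_ _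
    calc _ ≤ ∑ _e ∈ (treeInstance p k).edges, (2 * (k + 2) + p * (k + 3)) :=
          sum_le_sum fun e _ => Nat.add_le_add (Nat.mul_le_mul_left 2 (size_le_self _))
            (encVec_uniformCost_le p _ _)
      _ ≤ _ := by
        rw [sum_const, smul_eq_mul]
        exact Nat.mul_le_mul_right _ ((card_le_univ _).trans (card_sym2_fin_le (k + 2)))
  · obtain ⟨F, hF, hT⟩ := F
    have h := ((SimpleGraph.isTree_iff_connected_and_card).1 hT).2
    change Finset (Sym2 (Fin (k + 2))) at F
    have hset : (SimpleGraph.fromEdgeSet (F : Set (Sym2 (Fin (k + 2))))).edgeSet = F := by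
      rw [SimpleGraph.edgeSet_fromEdgeSet, sdiff_eq_left, Set.disjoint_left]
      exact fun e he hd => (mem_filter.1 (hF he)).2 hd
    change #F = k + 1
    change Nat.card (SimpleGraph.fromEdgeSet (F : Set (Sym2 (Fin (k + 2))))).edgeSet + 1
      = Nat.card (Fin (k + 2)) at h
    rw [hset] at h
    simpa using h
  -- Vertex 1 hangs from 0, and vertex i + 2 hangs from 0 or from 1 according to whether its special
  -- edge is wanted.
  · let q : Fin (k + 1) → Fin (k + 2) := Fin.cases 0 fun i => if i ∈ S then 0 else 1
    have hq : ∀ v, q v < v.succ := by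
      intro v
      refine Fin.cases ?_ (fun i => ?_) v
      · simp [q]
      · simp only [q, Fin.cases_succ]
        split_ifs <;> simp [Fin.lt_def]
    refine ⟨⟨parentEdges q, fun e he => ?_, parentEdges_isTree hq⟩, fun i => ?_⟩
    · obtain ⟨v, -, rfl⟩ := mem_image.1 he
      exact mem_filter.2 ⟨mem_univ _, fun h => (hq v).ne (by simpa using h)⟩
    · change Multiset.count _ (parentEdges q).val = _
      rw [Multiset.count_eq_of_nodup (parentEdges q).nodup]
      refine if_congr ?_ rfl rfl
      rw [mem_val, parentEdges, mem_image]
      constructor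
      · rintro ⟨v, -, hv⟩
        rcases Sym2.eq_iff.1 hv with ⟨h1, h2⟩ | ⟨h1, h2⟩
        · obtain rfl := Fin.succ_injective _ h2
          by_contra hi
          simp [q, hi] at h1
        · exact absurd h2 (Fin.succ_ne_zero _)
      · intro hi
        exact ⟨i.succ, mem_univ _, by simp [q, hi]⟩

/-! ### Cuts -/

/-- The arcs leaving a cut of the complete network: its vertices send an arc to the sink, the
other vertices receive an arc from the source. -/
theorem cut_arcs_eq {n : ℕ} {s t : Fin n} (hst : s ≠ t) {S : Finset (Fin n)} (hs : s ∈ S)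
    (ht : t ∉ S) :
    (univ.filter fun a : Fin n × Fin n => a.1 ≠ a.2 ∧ (a.1 = s ∨ a.2 = t)).filter
      (fun a => a.1 ∈ S ∧ a.2 ∉ S) =
    (univ.erase t).image fun v => if v ∈ S then (v, t) else (s, v) := by
  ext ⟨u, v⟩
  simp only [mem_filter, mem_univ, true_and, mem_image, mem_erase, and_true]
  constructor
  · rintro ⟨⟨-, rfl | rfl⟩, hu, hv⟩
    · by_cases h : v = t
      · exact ⟨u, hst, by simp [hu, h]⟩
      · exact ⟨v, h, by simp [hv]⟩
    · exact ⟨u, fun h => hv (h ▸ hu), by simp [hu]⟩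
  · rintro ⟨w, hw, h⟩
    split_ifs at h with hwS <;> obtain ⟨rfl, rfl⟩ := Prod.mk.inj h
    · exact ⟨⟨hw, Or.inr rfl⟩, hwS, ht⟩
    · exact ⟨⟨fun h => hwS (h ▸ hs), Or.inl rfl⟩, hs, hwS⟩

/-- Each vertex other than the sink accounts for exactly one cut arc, whichever side it lies on, so
the number of arcs is the same for all cuts. -/
theorem card_cut_arcs {n : ℕ} {s t : Fin n} (hst : s ≠ t) {S : Finset (Fin n)} (hs : s ∈ S)
    (ht : t ∉ S) :
    #((univ.filter fun a : Fin n × Fin n => a.1 ≠ a.2 ∧ (a.1 = s ∨ a.2 = t)).filter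
      (fun a => a.1 ∈ S ∧ a.2 ∉ S)) = n - 1 := by
  rw [cut_arcs_eq hst hs ht, card_image_of_injOn, card_erase_of_mem (mem_univ _), card_univ,
    Fintype.card_fin]
  intro u hu v hv h
  have hu' : u ≠ t := by simpa using hu
  have hv' : v ≠ t := by simpa using hv
  dsimp only at h
  split_ifs at h with h1 h2 h2 <;> obtain ⟨h3, h4⟩ := Prod.mk.inj h
  · exact h3
  · exact absurd h4.symm hv'
  · exact absurd h4 hu'
  · exact h4

/-- All arcs out of the source `0` and into the sink `k + 1`; those from the source to the inner
vertices are special. -/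
abbrev cutInstance (p k : ℕ) : DirectedNetwork p where
  n := k + 2
  s := 0
  t := Fin.last (k + 1)
  s_ne_t := (Fin.last_pos).ne
  arcs := univ.filter fun a => a.1 ≠ a.2 ∧ (a.1 = 0 ∨ a.2 = Fin.last (k + 1))
  no_loops _ ha := (mem_filter.1 ha).2.1
  cost := uniformCost p fun i : Fin k => (0, i.succ.castSucc)
  cost_pos _ _ := uniformCost_pos _ _ _

theorem directedNetwork_enc_le {p : ℕ} (N : DirectedNetwork p) {B : ℕ}
    (hB : ∀ a ∈ N.arcs, encVec (N.cost a) ≤ B) :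
    N.enc ≤ N.n + 2 * N.n + N.n * N.n * (2 * N.n + B) := by
  unfold DirectedNetwork.enc
  have h1 := size_le_self N.n
  have h2 : #N.arcs ≤ N.n * N.n := by simpa using card_le_univ N.arcs
  have h3 : ∑ a ∈ N.arcs, (2 * Nat.size N.n + encVec (N.cost a)) ≤
      #N.arcs * (2 * N.n + B) := by
    rw [← smul_eq_mul]
    exact sum_le_card_nsmul _ _ _ fun a ha =>
      Nat.add_le_add (Nat.mul_le_mul_left 2 h1) (hB a ha)
  have h4 := Nat.mul_le_mul_right (2 * N.n + B) h2
  omega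

theorem minCut_hasHardInstances (p : ℕ) : HasHardInstances (minCut p) := by
  refine hasHardInstances_of_uniform (minCut p) rfl (cutInstance p)
    ((.X + 2) + 2 * (.X + 2) +
      (.X + 2) * (.X + 2) * (2 * (.X + 2) + (p : Polynomial ℕ) * (.X + 3)))
    (fun k => ?_) (fun k => Fin (k + 2) × Fin (k + 2)) (fun k i => (0, i.succ.castSucc))
    (fun k S => ((cutInstance p k).arcs.filter fun a => a.1 ∈ S.1 ∧ a.2 ∉ S.1).val)
    (fun k S i => rfl) (fun k => k + 1) (fun k => k.succ_pos)
    (fun k S => card_cut_arcs (cutInstance p k).s_ne_t S.2.1 S.2.2) (fun k S => ?_)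
  · simp only [Polynomial.eval_add, Polynomial.eval_mul, Polynomial.eval_X,
      Polynomial.eval_natCast, Polynomial.eval_ofNat]
    exact directedNetwork_enc_le (cutInstance p k) fun a _ => encVec_uniformCost_le p _ _
  -- The special arc from the source to an inner vertex is cut exactly when that vertex is left out,
  -- hence the complement.
  · let T : Finset (Fin (k + 2)) := insert 0 (Sᶜ.image fun i => i.succ.castSucc)
    have hT : ∀ i : Fin k, i.succ.castSucc ∈ T ↔ i ∉ S := fun i => by
      simp only [T, mem_insert, mem_image, mem_compl]
      constructor
      · rintro (h | ⟨j, hj, h⟩)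
        · exact absurd h (by simp [Fin.ext_iff])
        · exact Fin.succ_injective _ (Fin.castSucc_injective _ h) ▸ hj
      · exact fun h => Or.inr ⟨i, h, rfl⟩
    refine ⟨⟨T, mem_insert_self _ _, ?_⟩, fun i => ?_⟩
    · change Fin.last (k + 1) ∉ T
      simp only [T, mem_insert, mem_image, not_or, not_exists, not_and]
      exact ⟨Fin.last_pos.ne', fun i _ => (Fin.castSucc_lt_last _).ne⟩
    · rw [Multiset.count_eq_of_nodup (nodup _)]
      refine if_congr ?_ rfl rfl
      rw [mem_val, mem_filter, hT, not_not]
      refine ⟨fun h => h.2.2, fun h => ⟨mem_filter.2 ⟨mem_univ _, ?_, Or.inl rfl⟩,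
        mem_insert_self _ _, h⟩⟩
      simp [Fin.ext_iff]

/-! ### Knapsack -/

/-- The ratio of consecutive central binomial coefficients is 2(2n + 1)/(n + 1), which is at least
2. -/
theorem two_pow_le_centralBinom (n : ℕ) : 2 ^ n ≤ n.centralBinom := by
  induction n with
  | zero => simp
  | succ n ih =>
    have h := Nat.succ_mul_centralBinom_succ n
    refine Nat.le_of_mul_le_mul_left (c := n + 1) ?_ n.succ_pos
    rw [h, pow_succ]
    nlinarith

/-- Items of weight `1` with profits `2 ^ a` and `2 ^ (2 * (k + 1)) - 2 ^ a`; half of the items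
fit. -/
abbrev knapsackInstance (p k : ℕ) : KnapsackInstance p where
  n := 2 * (k + 1)
  weight _ := 1
  weight_pos _ := one_pos
  capacity := (k + 1 : ℕ)
  capacity_pos := by positivity
  profit a := biVec p (2 ^ (a : ℕ)) (2 ^ (2 * (k + 1)) - 2 ^ (a : ℕ))
  profit_pos a := biVec_pos (by positivity)
    (Nat.sub_pos_of_lt (Nat.pow_lt_pow_right (by norm_num) a.2))

theorem sum_knapsack_profit (p k : ℕ) (S : Finset (Fin (2 * (k + 1)))) (i : Fin p) :
    ∑ a ∈ S, (knapsackInstance p k).profit a i =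
      if (i : ℕ) = 0 then ∑ a ∈ S, (2 : ℚ) ^ (a : ℕ)
      else ∑ a ∈ S, ((2 : ℚ) ^ (2 * (k + 1)) - 2 ^ (a : ℕ)) := by
  simp only [biVec]
  split_ifs
  · simp
  · refine sum_congr rfl fun a _ => ?_
    rw [Nat.cast_sub (Nat.pow_le_pow_right (by norm_num) a.2.le)]
    push_cast
    rfl

theorem knapsack_hasHardInstances (p : ℕ) : HasHardInstances (knapsack p) := by
  have hpow : ∀ k (a : Fin (2 * (k + 1))), (2 : ℚ) ^ (a : ℕ) < 2 ^ (2 * (k + 1)) := fun k a =>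
    pow_lt_pow_right₀ (by norm_num) a.2
  refine hasHardInstances_of_biobjective (knapsack p) (knapsackInstance p)
    (2 * (.X + 1) + (.X + 3) + 2 * (.X + 1) * (3 + (p : Polynomial ℕ) * (2 * (.X + 1) + 1 + 2)))
    (fun k => ?_)
    (fun k S => ∑ a ∈ S.1, (2 : ℚ) ^ (a : ℕ))
    (fun k S => ∑ a ∈ S.1, ((2 : ℚ) ^ (2 * (k + 1)) - 2 ^ (a : ℕ)))
    (fun k S i => sum_knapsack_profit p k S.1 i)
    (fun k S => sum_pos (fun a _ => by positivity) S.2.1)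
    (fun k S => sum_pos (fun a _ => sub_pos.2 (hpow k a)) S.2.1)
    (fun k => {S : Finset (Fin (2 * (k + 1))) // #S = k + 1}) (fun k => ?_)
    (fun k S => ⟨S.1, card_pos.1 (by rw [S.2]; exact k.succ_pos), by simp [S.2]⟩)
    (fun k S T h => ?_) (fun h => nomatch h) (fun _ k S x h1 h2 => ?_)
  · simp only [Polynomial.eval_add, Polynomial.eval_mul, Polynomial.eval_X, Polynomial.eval_one,
      Polynomial.eval_natCast, Polynomial.eval_ofNat]
    refine Nat.add_le_add (Nat.add_le_add_left (encRat_natCast_le Nat.lt_two_pow_self) _) ?_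
    calc _ ≤ ∑ _a : Fin (2 * (k + 1)), (3 + p * (2 * (k + 1) + 1 + 2)) := by
          refine sum_le_sum fun a _ => Nat.add_le_add ?_ (encVec_biVec_le ?_ ?_)
          · simpa using encRat_natCast_le (a := 1) (k := 1) (by norm_num)
          · exact Nat.pow_lt_pow_right (by norm_num) (by omega)
          · exact (Nat.sub_le _ _).trans_lt (Nat.pow_lt_pow_right (by norm_num) (by omega))
      _ = _ := by simp
  · rw [Fintype.card_finset_len, Fintype.card_fin, ← Nat.centralBinom_eq_two_mul_choose]
    exact (Nat.pow_le_pow_right (by norm_num) k.le_succ).trans (two_pow_le_centralBinom _)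
  · refine Subtype.ext (sum_two_pow_fin_injective _ ?_)
    dsimp only at h ⊢
    exact_mod_cast h
  -- With C = 2^(2(k + 1)), F + G equals C times the number of items, so the sum for `x` is at most
  -- the one for `S`. A gain in G therefore excludes a strict gain in F.
  · have hx : (#x.1 : ℚ) ≤ k + 1 := by simpa using x.2.2
    have hC : (0 : ℚ) < 2 ^ (2 * (k + 1)) := by positivity
    have hS : (#S.1 : ℚ) = k + 1 := by rw [S.2]; push_cast; rfl
    simp only [sum_sub_distrib, sum_const, nsmul_eq_mul, hS] at h2
    refine le_antisymm ?_ h1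
    have := mul_le_mul_of_nonneg_right hx hC.le
    linarith

/-! ### Shortest paths -/

/-- The complete acyclic network on `0, …, k + 1`: the first cost of an arc is determined by its
head, and the sum of the first two costs is proportional to the length of the arc. -/
abbrev pathInstance (p k : ℕ) : DirectedNetwork p where
  n := k + 2
  s := 0
  t := Fin.last (k + 1)
  s_ne_t := (Fin.last_pos).ne
  arcs := univ.filter fun a => a.1 < a.2
  no_loops _ ha := (mem_filter.1 ha).2.ne
  cost a := biVec p (2 ^ (a.2 : ℕ)) (2 ^ (k + 2) * (a.2 - a.1) - 2 ^ (a.2 : ℕ))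
  cost_pos a ha := biVec_pos (by positivity) <| by
    have h : (a.1 : ℕ) < a.2 := (mem_filter.1 ha).2
    refine Nat.sub_pos_of_lt ((Nat.pow_lt_pow_right (by norm_num) a.2.2).trans_le ?_)
    exact Nat.le_mul_of_pos_right _ (by omega)

/-- The arc lengths telescope to t - u, so the two costs of a path add up to a constant. The first
cost reads off the visited vertices other than the starting one. -/
theorem sum_path_cost (p k : ℕ) (i : Fin p) (l : List (Fin (k + 2))) (u t : Fin (k + 2))
    (hchain : (u :: l).IsChain (· < ·)) (hlast : (u :: l).getLast? = some t) :
    (((u :: l).zip l).map fun a => (pathInstance p k).cost a i).sum =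
      if (i : ℕ) = 0 then (l.map fun v : Fin (k + 2) => (2 : ℚ) ^ (v : ℕ)).sum
      else (2 : ℚ) ^ (k + 2) * (t - u) - (l.map fun v : Fin (k + 2) => (2 : ℚ) ^ (v : ℕ)).sum := by
  induction l generalizing u with
  | nil =>
    obtain rfl : u = t := by simpa using hlast
    simp
  | cons v l ih =>
    rw [List.isChain_cons_cons] at hchain
    have huv : (u : ℕ) < v := hchain.1
    have hpow : 2 ^ (v : ℕ) ≤ 2 ^ (k + 2) * ((v : ℕ) - u) :=
      (Nat.pow_le_pow_right (by norm_num) v.2.le).trans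
        (Nat.le_mul_of_pos_right _ (by omega))
    rw [List.zip_cons_cons, List.map_cons, List.sum_cons,
      ih v hchain.2 (by simpa using hlast)]
    simp only [biVec, List.map_cons, List.sum_cons]
    split_ifs
    · push_cast
      rfl
    · rw [Nat.cast_sub hpow]
      push_cast [Nat.cast_sub huv.le]
      ring

theorem sum_map_two_pow_lt {n : ℕ} {l : List (Fin n)} (hl : l.Nodup) :
    (l.map fun v : Fin n => (2 : ℚ) ^ (v : ℕ)).sum < 2 ^ n := by
  rw [← List.sum_toFinset _ hl]
  exact_mod_cast sum_two_pow_fin_lt l.toFinset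

/-- The path through the inner vertices given by `S`, in increasing order. -/
def innerPath {k : ℕ} (S : Finset (Fin k)) : List (Fin (k + 2)) :=
  0 :: ((S.map ((Fin.succEmb k).trans Fin.castSuccEmb)).sort (· ≤ ·) ++ [Fin.last (k + 1)])

theorem innerPath_pairwise {k : ℕ} (S : Finset (Fin k)) : (innerPath S).Pairwise (· < ·) := by
  rw [innerPath, List.pairwise_cons, List.pairwise_append]
  refine ⟨fun a ha => ?_, (sortedLT_sort _).pairwise, List.pairwise_singleton _ _,
    fun a ha b hb => ?_⟩
  · simp only [List.mem_append, mem_sort, mem_map, List.mem_singleton] at ha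
    rcases ha with ⟨i, -, rfl⟩ | rfl
    · simp [Fin.lt_def]
    · exact Fin.last_pos
  · rw [mem_sort, mem_map] at ha
    obtain ⟨i, -, rfl⟩ := ha
    rw [List.mem_singleton.1 hb]
    exact Fin.castSucc_lt_last _

theorem innerPath_isPath (p : ℕ) {k : ℕ} (S : Finset (Fin k)) :
    (pathInstance p k).IsPath (innerPath S) := by
  refine ⟨rfl, ?_, (innerPath_pairwise S).imp ne_of_lt, ?_⟩
  · change (innerPath S).getLast? = some (Fin.last (k + 1))
    rw [innerPath, ← List.cons_append, List.getLast?_concat]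
  · exact (innerPath_pairwise S).isChain.imp fun a b h => mem_filter.2 ⟨mem_univ _, h⟩

theorem sum_innerPath {k : ℕ} (S : Finset (Fin k)) :
    ((innerPath S).tail.map fun v : Fin (k + 2) => (2 : ℚ) ^ (v : ℕ)).sum =
      ((∑ v ∈ S.map ((Fin.succEmb k).trans Fin.castSuccEmb), 2 ^ (v : ℕ) : ℕ) : ℚ)
        + 2 ^ (k + 1) := by
  rw [innerPath, List.tail_cons, List.map_append, List.sum_append,
    ← List.sum_toFinset _ (sort_nodup _ _), sort_toFinset]
  push_cast
  simp

theorem shortestPath_hasHardInstances (p : ℕ) : HasHardInstances (shortestPath p) := by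
  -- Paths in `pathInstance` start at 0, increase strictly, and have a nonempty tail because source
  -- and sink differ.
  have hcons : ∀ k (l : (shortestPath p).Sol (pathInstance p k)),
      ∃ m : List (Fin (k + 2)), l.1 = 0 :: m ∧ m ≠ [] ∧ m.Nodup ∧
        (0 :: m).IsChain (· < ·) ∧ (0 :: m).getLast? = some (Fin.last (k + 1)) := by
    rintro k ⟨_ | ⟨u, m⟩, h1, h2, h3, h4⟩
    · cases h1
    obtain rfl : u = (0 : Fin (k + 2)) := by simpa using h1
    refine ⟨m, rfl, ?_, (List.nodup_cons.1 h3).2, h4.imp fun a b h => ?_, h2⟩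
    · rintro rfl
      simp at h2
    · exact (mem_filter (p := fun a : Fin (k + 2) × Fin (k + 2) => a.1 < a.2)).1 h |>.2
  refine hasHardInstances_of_biobjective (shortestPath p) (pathInstance p)
    ((.X + 2) + 2 * (.X + 2) + (.X + 2) * (.X + 2) *
      (2 * (.X + 2) + (p : Polynomial ℕ) * ((.X + 2) + (.X + 2) + 2)))
    (fun k => ?_)
    (fun k l => (l.1.tail.map fun v : Fin (k + 2) => (2 : ℚ) ^ (v : ℕ)).sum)
    (fun k l => 2 ^ (k + 2) * (k + 1) - (l.1.tail.map fun v : Fin (k + 2) => (2 : ℚ) ^ (v : ℕ)).sum)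
    (fun k l i => ?_) (fun k l => ?_) (fun k l => ?_)
    (fun k => Finset (Fin k)) (fun k => by simp)
    (fun k S => ⟨innerPath S, innerPath_isPath p S⟩)
    (fun k S T h => ?_) (fun _ k S x h1 h2 => ?_) (fun h => nomatch h)
  · simp only [Polynomial.eval_add, Polynomial.eval_mul, Polynomial.eval_X,
      Polynomial.eval_natCast, Polynomial.eval_ofNat]
    refine directedNetwork_enc_le (pathInstance p k) fun a _ => encVec_biVec_le ?_ ?_
    · exact Nat.pow_lt_pow_right (by norm_num) (by omega)
    · refine (Nat.sub_le _ _).trans_lt ?_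
      rw [pow_add 2 (k + 2) (k + 2)]
      refine Nat.mul_lt_mul_of_pos_left ?_ (Nat.two_pow_pos _)
      exact ((Nat.sub_le _ _).trans_lt a.2.2).trans Nat.lt_two_pow_self
  · obtain ⟨m, hm, -, -, hc, hl⟩ := hcons k l
    change ((l.1.zip l.1.tail).map fun a => (pathInstance p k).cost a i).sum = _
    rw [hm, List.tail_cons, sum_path_cost p k i m 0 (Fin.last (k + 1)) hc hl]
    simp
  · obtain ⟨m, hm, hne, -⟩ := hcons k l
    rw [hm, List.tail_cons]
    refine List.sum_pos _ (fun x hx => ?_) (by simpa only [ne_eq, List.map_eq_nil_iff] using hne)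
    obtain ⟨v, -, rfl⟩ := List.mem_map.1 hx
    positivity
  · obtain ⟨m, hm, -, hnd, -⟩ := hcons k l
    rw [hm, List.tail_cons, sub_pos]
    -- The powers of two at distinct vertices sum to less than 2^(k + 2), already the price of a
    -- single unit of length.
    refine (sum_map_two_pow_lt hnd).trans_le (le_mul_of_one_le_right (by positivity) ?_)
    simp
  · simp only [sum_innerPath, add_left_inj, Nat.cast_inj] at h
    exact map_injective _ (sum_two_pow_fin_injective _ h)
  · exact le_antisymm h1 ((sub_le_sub_iff_left _).1 h2)

/-! ### Traveling salesman -/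

/-- Exchange `3 * j + 1` and `3 * j + 2` for all `j ∈ T`. -/
def blockSwap {k : ℕ} (T : Finset (Fin k)) (v : ℕ) : ℕ :=
  if ∃ j ∈ T, (j : ℕ) = v / 3 then
    if v % 3 = 1 then v + 1 else if v % 3 = 2 then v - 1 else v
  else v

theorem blockSwap_div {k : ℕ} (T : Finset (Fin k)) (v : ℕ) : blockSwap T v / 3 = v / 3 := by
  unfold blockSwap
  split_ifs <;> omega

theorem blockSwap_involutive {k : ℕ} (T : Finset (Fin k)) :
    Function.Involutive (blockSwap T) := by
  intro v
  by_cases h : ∃ j ∈ T, (j : ℕ) = v / 3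
  · have h' : ∃ j ∈ T, (j : ℕ) = blockSwap T v / 3 := by rwa [blockSwap_div]
    rw [blockSwap, if_pos h', blockSwap, if_pos h]
    split_ifs <;> omega
  · have h' : ¬∃ j ∈ T, (j : ℕ) = blockSwap T v / 3 := by rwa [blockSwap_div]
    rw [blockSwap, if_neg h', blockSwap, if_neg h]

theorem blockSwap_three_mul {k : ℕ} (T : Finset (Fin k)) (j : ℕ) :
    blockSwap T (3 * j) = 3 * j := by
  unfold blockSwap
  split_ifs <;> omega

theorem blockSwap_three_mul_add_one {k : ℕ} (T : Finset (Fin k)) (i : Fin k) :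
    blockSwap T (3 * (i : ℕ) + 1) = if i ∈ T then 3 * (i : ℕ) + 2 else 3 * (i : ℕ) + 1 := by
  have h : (∃ j ∈ T, (j : ℕ) = (3 * (i : ℕ) + 1) / 3) ↔ i ∈ T := by
    rw [show (3 * (i : ℕ) + 1) / 3 = i by omega]
    simp [Fin.val_inj]
  unfold blockSwap
  simp only [h]
  split_ifs <;> omega

theorem blockSwap_lt {k m : ℕ} (T : Finset (Fin k)) {v : ℕ} (hv : v < 3 * m) :
    blockSwap T v < 3 * m := by
  have := blockSwap_div T v
  omega

/-- `blockSwap` as a permutation of the cities. -/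
def blockSwapPerm {k : ℕ} (T : Finset (Fin k)) : Equiv.Perm (Fin (3 * k + 6)) :=
  Function.Involutive.toPerm
    (fun v => ⟨blockSwap T v, blockSwap_lt (m := k + 2) T (by omega)⟩)
    fun v => Fin.ext (blockSwap_involutive T v)

theorem val_blockSwapPerm {k : ℕ} (T : Finset (Fin k)) (v : Fin (3 * k + 6)) :
    (blockSwapPerm T v : ℕ) = blockSwap T v := rfl

/-- The tour visiting the cities in the order given by `blockSwapPerm`. -/
def blockTour {k : ℕ} (T : Finset (Fin k)) : Equiv.Perm (Fin (3 * k + 6)) :=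
  blockSwapPerm T * finRotate (3 * k + 6) * (blockSwapPerm T)⁻¹

theorem finRotate_isCycleOn_univ (n : ℕ) : (finRotate (n + 2)).IsCycleOn Set.univ := by
  convert (isCycle_finRotate (n := n)).isCycleOn
  ext v
  simp

/-- The tour is a conjugate of the full rotation, and conjugation preserves being a single cycle. -/
theorem blockTour_isCycleOn_univ {k : ℕ} (T : Finset (Fin k)) :
    (blockTour T).IsCycleOn Set.univ := by
  have h := (finRotate_isCycleOn_univ (3 * k + 4)).conj (g := blockSwapPerm T)
  rwa [Set.image_univ, (blockSwapPerm T).surjective.range_eq] at h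

/-- The edge between the first two cities of the `i`-th block. -/
def blockEdge {k : ℕ} (i : Fin k) : Sym2 (Fin (3 * k + 6)) :=
  s(⟨3 * i, by omega⟩, ⟨3 * i + 1, by omega⟩)

/-- The edges of a tour. -/
def tourEdges {n : ℕ} (σ : Equiv.Perm (Fin n)) : Multiset (Sym2 (Fin n)) :=
  univ.val.map fun v => s(v, σ v)

theorem tourEdges_blockTour {k : ℕ} (T : Finset (Fin k)) :
    tourEdges (blockTour T) = univ.val.map fun u =>
      s(blockSwapPerm T u, blockSwapPerm T (finRotate (3 * k + 6) u)) := by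
  rw [tourEdges, ← Multiset.map_univ_val_equiv (blockSwapPerm T), Multiset.map_map]
  simp [blockTour]

theorem val_finRotate {n : ℕ} (u : Fin (n + 1)) :
    (finRotate (n + 1) u : ℕ) = if (u : ℕ) = n then 0 else (u : ℕ) + 1 := by
  rw [coe_finRotate]
  simp [Fin.ext_iff]

/-- An unswapped block is visited as 3i, 3i + 1, 3i + 2 and uses its block edge right after 3i. A
swapped block is visited as 3i, 3i + 2, 3i + 1, and the next city is 3i + 3, so 3i and 3i + 1 are
not neighbours. -/
theorem blockEdge_eq_iff {k : ℕ} (T : Finset (Fin k)) (i : Fin k) (u : Fin (3 * k + 6)) :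
    blockEdge i = s(blockSwapPerm T u, blockSwapPerm T (finRotate (3 * k + 6) u)) ↔
      i ∉ T ∧ (u : ℕ) = 3 * i := by
  -- The two spare blocks at the end are never swapped, so the step that closes the tour, from 3k +
  -- 5 to 0, is no block edge.
  have hc : (finRotate (3 * k + 6) u : ℕ) = if (u : ℕ) = 3 * k + 5 then 0 else (u : ℕ) + 1 :=
    val_finRotate u
  have hi := i.2
  have hu := u.2
  have h0 := blockSwap_three_mul T i
  have h1 := blockSwap_three_mul_add_one T i
  rw [blockEdge, Sym2.eq_iff]
  simp only [Fin.ext_iff, val_blockSwapPerm]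
  generalize finRotate (3 * k + 6) u = w at hc ⊢
  -- Since the swap is an involution, it can be moved onto 3i and 3i + 1, where its values are
  -- known; only linear arithmetic remains.
  have hswap : ∀ a b, a = blockSwap T b ↔ b = blockSwap T a := fun a b =>
    ⟨fun h => by rw [h, blockSwap_involutive T b], fun h => by rw [h, blockSwap_involutive T a]⟩
  rw [hswap _ (u : ℕ), hswap _ (w : ℕ), hswap _ (u : ℕ), hswap _ (w : ℕ), h0, h1]
  by_cases hT : i ∈ T <;> simp only [hT, if_true, if_false, not_true, not_false_iff, true_and,
    false_and, iff_false] <;> split_ifs at hc <;> omega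

/-- Block edges are special. -/
abbrev tspInstance (p k : ℕ) : TSPInstance p where
  n := 3 * k + 6
  three_le := by omega
  cost := uniformCost p (blockEdge (k := k))
  cost_pos _ _ := uniformCost_pos _ _ _

theorem travelingSalesman_hasHardInstances (p : ℕ) :
    HasHardInstances (travelingSalesman p) := by
  refine hasHardInstances_of_uniform (travelingSalesman p) rfl (tspInstance p)
    ((3 * .X + 6) + (3 * .X + 6) * (3 * .X + 6) * ((p : Polynomial ℕ) * (.X + 3)))
    (fun k => ?_) (fun k => Sym2 (Fin (3 * k + 6))) (fun k => blockEdge)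
    (fun k σ => tourEdges σ.1) (fun k σ i => ?_) (fun k => 3 * k + 6) (fun k => by omega)
    (fun k σ => by simp [tourEdges]) (fun k S => ?_)
  · simp only [Polynomial.eval_add, Polynomial.eval_mul, Polynomial.eval_X,
      Polynomial.eval_natCast, Polynomial.eval_ofNat]
    refine Nat.add_le_add_left ?_ _
    refine (sum_le_card_nsmul _ _ (p * (k + 3)) fun e _ => encVec_uniformCost_le p _ _).trans ?_
    rw [smul_eq_mul]
    exact Nat.mul_le_mul_right _ ((card_le_univ _).trans (card_sym2_fin_le (3 * k + 6)))
  · rw [tourEdges, Multiset.map_map]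
    rfl
  -- Swapping a block destroys its special edge, so the blocks outside S are swapped.
  · refine ⟨⟨blockTour Sᶜ, blockTour_isCycleOn_univ _⟩, fun i => ?_⟩
    change (tourEdges (blockTour Sᶜ)).count _ = _
    rw [tourEdges_blockTour, Multiset.count_map]
    simp only [blockEdge_eq_iff, mem_compl, not_not]
    change #(univ.filter fun u : Fin (3 * k + 6) => i ∈ S ∧ (u : ℕ) = 3 * i) = _
    split_ifs with hi
    · rw [card_eq_one]
      refine ⟨⟨3 * i, by omega⟩, ?_⟩
      ext u
      simp [hi, Fin.ext_iff]
    · simp [hi]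

end MOO

theorem theorem3 (p : ℕ) (hp : 2 ≤ p) (Pr : MOO.Problem p)
    (hPr : Pr = MOO.shortestPath p ∨ Pr = MOO.spanningTree p ∨ Pr = MOO.assignment p ∨
      Pr = MOO.minCut p ∨ Pr = MOO.knapsack p ∨ Pr = MOO.travelingSalesman p) :
    ∃ I : ℕ → Pr.Inst,
      (∀ (n : ℕ) (x : Pr.Sol (I n)) (i : Fin p), 0 < Pr.obj (I n) x i) ∧
      ∀ q : Polynomial ℕ, ∀ᶠ n in Filter.atTop, ∀ ε : ℝ, 0 < ε →
        ∀ P : Set (Pr.Sol (I n)),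
          MOO.IsApproximationSet (MOO.OneExactQuasiExactDom Pr (I n) 2 ε) P →
            ((q.eval (Pr.enc (I n)) : ℕ) : ℕ∞) < P.encard := by
  rcases hPr with rfl | rfl | rfl | rfl | rfl | rfl
  exacts [MOO.shortestPath_hasHardInstances p, MOO.spanningTree_hasHardInstances p,
    MOO.assignment_hasHardInstances p, MOO.minCut_hasHardInstances p,
    MOO.knapsack_hasHardInstances p, MOO.travelingSalesman_hasHardInstances p]
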